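/- For $n\ge 0$ define $w_n(x)\in\mathbb{Z}[x]$ by $w_0(x)=w_1(x)=1$ and $w_n(x)=(x-2)w_{n-1}(x)-w_{n-2}(x)$ for $n\ge 2$. For $n\ge 2$ put $\zeta=e^{i\pi/(2(2n-1))}$ and, for each divisor $d>1$ of $2n-1$, let $$\Omega_d(x)=\prod_{\substack{1\le j\le n-1\\ \gcd(2j-1,\,2n-1)=(2n-1)/d}}\Bigl(x-\bigl(\zeta^{2(2j-1)}+\zeta^{-2(2j-1)}+2\bigr)\Bigr).$$ An integer $N\ge 2$ satisfies Condition C if, for some distinct odd primes $p,q$ and positive integers $a,b$, either $N$ is odd and $N=p^a$, or $N=p^aq^b$ with $\gcd(\phi(p^a),\phi(q^b))=2$; or $N$ is even and $N=2p^a$, or $N=2p^aq^b$ with $\gcd(\phi(p^a),\phi(q^b))=2$. Let $f\in\mathbb{Z}[x]$ be monic of degree $N$ and irreducible over $\mathbb{Q}$. Then $f$ is called monogenic if, for $\theta$ with $f(\theta)=0$, the set $\{1,\theta,\dots,\theta^{N-1}\}$ is a $\mathbb{Z}$-basis of the ring of integers of $\mathbb{Q}(\theta)$; and $f$ is called cyclic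 if its Galois group over $\mathbb{Q}$ is isomorphic to the cyclic group of order $N$. **Corollary 1.4.** (1) Let $n\ge 2$ be such that $2n-1$ satisfies Condition C. Then the monic irreducible factors of $w_n(x)$ are exactly the polynomials $\Omega_d(x)$ with $d\mid 2n-1$, $d>1$ (these have integer coefficients), and each of them is both monogenic and cyclic. (2) Let $n_1,n_2\ge 2$ with $n_1\ne n_2$ be such that $2n_1-1$ and $2n_2-1$ both satisfy Condition C. Then $\Omega_{2n_1-1}(x)$ and $\Omega_{2n_2-1}(x)$ are distinct, that is, $\mathbb{Q}(\alpha)\ne\mathbb{Q}(\beta)$ (as subfields of $\mathbb{C}$) for all $\alpha,\beta\in\mathbb{C}$ with $\Omega_{2n_1-1}(\alpha)=0=\Omega_{2n_2-1}(\beta)$. -/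

import Mathlib

open Polynomial NumberField IntermediateField

namespace RecMono

/-- The right-hand side of the odd case of Condition C: `M = p ^ a`, or `M = p ^ a * q ^ b` with
`gcd (φ (p ^ a), φ (q ^ b)) = 2`, for distinct odd primes `p`, `q` and positive `a`, `b`. -/
def OddShape (M : ℕ) : Prop :=
  (∃ p a : ℕ, p.Prime ∧ Odd p ∧ 0 < a ∧ M = p ^ a) ∨
  (∃ p q a b : ℕ, p.Prime ∧ Odd p ∧ q.Prime ∧ Odd q ∧ p ≠ q ∧ 0 < a ∧ 0 < b ∧
    M = p ^ a * q ^ b ∧ Nat.gcd (Nat.totient (p ^ a)) (Nat.totient (q ^ b)) = 2)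

/-- `N ≥ 2` satisfies Condition C. -/
def ConditionC (N : ℕ) : Prop :=
  2 ≤ N ∧ ((¬ 2 ∣ N ∧ OddShape N) ∨ (2 ∣ N ∧ ∃ M : ℕ, N = 2 * M ∧ OddShape M))

/-- The recurrence sequence `w 0 = w 1 = 1`, `w n = (X - 2) * w (n - 1) - w (n - 2)`. -/
noncomputable def w : ℕ → ℤ[X]
  | 0 => 1
  | 1 => 1
  | n + 2 => (X - C 2) * w (n + 1) - w n

/-- `ζ = exp (i π / (2 (2 n - 1)))`. -/
noncomputable def zeta (n : ℕ) : ℂ :=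
  Complex.exp (Complex.I * (Real.pi : ℂ) / (2 * (2 * (n : ℂ) - 1)))

/-- The polynomial `Ω_d`, for a divisor `d > 1` of `2 n - 1`, as a complex polynomial: the product
of `X - (ζ ^ (2 (2 j - 1)) + ζ ^ (- 2 (2 j - 1)) + 2)` over those `j ∈ {1, …, n - 1}` with
`gcd (2 j - 1, 2 n - 1) = (2 n - 1) / d`. -/
noncomputable def Omega (n d : ℕ) : ℂ[X] :=
  ∏ j ∈ (Finset.Icc 1 (n - 1)).filter
      (fun j => Nat.gcd (2 * j - 1) (2 * n - 1) = (2 * n - 1) / d),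
    (X - C (zeta n ^ (2 * (2 * j - 1)) + (zeta n ^ (2 * (2 * j - 1)))⁻¹ + 2))

/-- The integer polynomial `f` is `Ω_d` (there is at most one such `f`). -/
def IsOmega (n d : ℕ) (f : ℤ[X]) : Prop :=
  f.map (Int.castRingHom ℂ) = Omega n d

/-- `f` is monogenic: it is monic, irreducible over `ℚ`, and for a root `θ` the elements
`1, θ, …, θ ^ (N - 1)`, `N = deg f`, form a `ℤ`-basis of the ring of integers of `ℚ(θ)`. -/
def Monogenic (f : ℤ[X]) : Prop :=
  f.Monic ∧ Irreducible (f.map (Int.castRingHom ℚ)) ∧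
    ∀ θ : ℂ, aeval θ f = 0 →
      ∃ b : Module.Basis (Fin f.natDegree) ℤ (𝓞 ℚ⟮θ⟯),
        ∀ i, (((b i : 𝓞 ℚ⟮θ⟯) : ℚ⟮θ⟯) : ℂ) = θ ^ (i : ℕ)

/-- `f` is cyclic: it is monic, irreducible over `ℚ`, and its Galois group over `ℚ` is the cyclic
group of order `deg f`. -/
def Cyclic (f : ℤ[X]) : Prop :=
  f.Monic ∧ Irreducible (f.map (Int.castRingHom ℚ)) ∧
    Nonempty ((f.map (Int.castRingHom ℚ)).Gal ≃* Multiplicative (ZMod f.natDegree))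

/-- `f` and `g` are distinct: `ℚ(α) ≠ ℚ(β)` whenever `f(α) = 0` and `g(β) = 0`. -/
def Distinct (f g : ℤ[X]) : Prop :=
  ∀ α β : ℂ, aeval α f = 0 → aeval β g = 0 → ℚ⟮α⟯ ≠ ℚ⟮β⟯

end RecMono

namespace RecMono

/-! Put θ(u) = 2 - (u + u⁻¹). The recurrence has a closed form at θ(u) (`aeval_theta_w`), by which
w_n(θ(u)) = 0 exactly when u^(2n-1) = 1 and u ≠ 1. So the roots of w_n are the θ(u) with u of order
d > 1 dividing 2n-1. Galois conjugacy groups them by d: Ω_d is the minimal polynomial of θ(u)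
(`isOmega_minpoly_theta`), and ℚ(θ(u)) is the maximal real subfield of ℚ(u).

Its ring of integers is ℤ[θ(u)], deduced from ℤ[u] being that of ℚ(u)
(`exists_int_map_of_isIntegral_theta`). Its Galois group is (ℤ/d)ˣ/{±1}, which Condition C makes
cyclic (`cyclic_minpoly_theta`). If two such fields, for odd orders m and n, are the same field F,
then adjoining both roots of unity to F gives degree at most 4 and a root of unity of order lcm(m,
n). Hence φ(lcm(m, n)) ≤ 2φ(m), which forces m = n (`eq_of_adjoin_theta_eq`). -/

/-! ### The substitution θ. -/

/-- The algebraic integer `2 - (u + u⁻¹)`. -/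
noncomputable def theta (u : ℂ) : ℂ := 2 - (u + u⁻¹)

lemma theta_mul_self {u : ℂ} (hu : u ≠ 0) : u * theta u = -(u - 1) ^ 2 := by
  rw [theta]; field_simp; ring

lemma theta_inv (u : ℂ) : theta u⁻¹ = theta u := by
  rw [theta, theta, inv_inv, add_comm u]

lemma theta_eq_iff {u v : ℂ} (hu : u ≠ 0) (hv : v ≠ 0) : theta u = theta v ↔ u = v ∨ u = v⁻¹ := by
  constructor
  · intro h
    have : (u - v) * (u * v - 1) = 0 := by
      unfold theta at h; field_simp at h; linear_combination -h
    rcases mul_eq_zero.1 this with h | h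
    · exact .inl (sub_eq_zero.1 h)
    · exact .inr (eq_inv_of_mul_eq_one_left (sub_eq_zero.1 h))
  · rintro (rfl | rfl)
    · rfl
    · exact theta_inv v

lemma exists_theta_eq (x : ℂ) : ∃ u : ℂ, u ≠ 0 ∧ theta u = x := by
  -- `s` is a square root of the discriminant of u² - (2 - x)u + 1.
  obtain ⟨s, hs⟩ := IsAlgClosed.exists_eq_mul_self ((2 - x) ^ 2 - 4)
  have hne : (2 - x + s) / 2 ≠ 0 := by
    intro h
    have h1 : s = x - 2 := by linear_combination 2 * h
    rw [h1] at hs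
    exact absurd (show (4 : ℂ) = 0 by linear_combination -hs) (by norm_num)
  refine ⟨(2 - x + s) / 2, hne, ?_⟩
  apply mul_left_cancel₀ hne
  rw [theta_mul_self hne]
  linear_combination (1 / 4) * hs

/-! ### Conjugates and degree of θ(u). -/

section Root

variable {d : ℕ} {u : ℂ}

lemma isIntegral_theta (hd : 0 < d) (hu : IsPrimitiveRoot u d) : IsIntegral ℤ (theta u) := by
  have h2 : IsIntegral ℤ (2 : ℂ) := by simpa using isIntegral_algebraMap (R := ℤ) (A := ℂ) (x := 2)
  exact h2.sub ((hu.isIntegral hd).add (hu.inv.isIntegral hd))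

lemma minpoly_theta_map (hd : 0 < d) (hu : IsPrimitiveRoot u d) :
    (minpoly ℤ (theta u)).map (Int.castRingHom ℚ) = minpoly ℚ (theta u) :=
  (minpoly.isIntegrallyClosed_eq_field_fractions' ℚ (isIntegral_theta hd hu)).symm

lemma theta_mem_adjoin (u : ℂ) : theta u ∈ ℚ⟮u⟯ := by
  have h := mem_adjoin_simple_self ℚ u
  have h2 : (2 : ℂ) ∈ ℚ⟮u⟯ := by exact_mod_cast IntermediateField.natCast_mem ℚ⟮u⟯ 2
  exact sub_mem h2 (add_mem h (inv_mem h))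

lemma finrank_adjoin_primitiveRoot (hd : 0 < d) (hu : IsPrimitiveRoot u d) :
    Module.finrank ℚ ℚ⟮u⟯ = d.totient := by
  rw [adjoin.finrank ((hu.isIntegral hd).tower_top), ← cyclotomic_eq_minpoly_rat hu hd,
    natDegree_cyclotomic]

lemma isCyclotomicExtension_adjoin [NeZero d] (hu : IsPrimitiveRoot u d) :
    IsCyclotomicExtension {d} ℚ ℚ⟮u⟯ :=
  (isCyclotomicExtension_singleton_iff_eq_adjoin d ℚ ℂ ℚ⟮u⟯ hu).2 rfl

/-- A root of the minimal polynomial of `theta u` is `theta v` for a primitive root `v`. -/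
lemma exists_primitiveRoot_of_root (hd : 0 < d) (hu : IsPrimitiveRoot u d) {z : ℂ}
    (hz : aeval z (minpoly ℤ (theta u)) = 0) : ∃ v, IsPrimitiveRoot v d ∧ z = theta v := by
  have : NeZero d := ⟨hd.ne'⟩
  have := isCyclotomicExtension_adjoin hu
  have := IsCyclotomicExtension.finiteDimensional {d} ℚ ℚ⟮u⟯
  set x : ℚ⟮u⟯ := ⟨theta u, theta_mem_adjoin u⟩ with hx
  have hmin : minpoly ℚ x = minpoly ℚ (theta u) :=
    (minpoly.algebraMap_eq (algebraMap ℚ⟮u⟯ ℂ).injective x).symm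
  have hz' : aeval z (minpoly ℚ x) = 0 := by
    rw [hmin, ← minpoly_theta_map hd hu]
    rw [show Int.castRingHom ℚ = algebraMap ℤ ℚ from rfl, aeval_map_algebraMap]
    exact hz
  -- Embed ℚ(u) into ℂ so that θ(u) goes to z; the image of u is the required root of unity.
  obtain ⟨φ, hφ⟩ := exists_algHom_of_splits_of_aeval
    (fun s => ⟨Algebra.IsIntegral.isIntegral s, IsAlgClosed.splits _⟩) hz'
  have hg : IsPrimitiveRoot (AdjoinSimple.gen ℚ u) d :=
    IsPrimitiveRoot.coe_submonoidClass_iff.1 hu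
  refine ⟨φ (AdjoinSimple.gen ℚ u), hg.map_of_injective φ.injective, ?_⟩
  have hx' : x = 2 - (AdjoinSimple.gen ℚ u + (AdjoinSimple.gen ℚ u)⁻¹) := Subtype.ext rfl
  have h2 : φ 2 = 2 := map_ofNat φ 2
  rw [← hφ, hx', theta]
  simp [h2]

/-- The minimal polynomial of `theta u` only depends on the order of `u`. -/
lemma minpoly_theta_eq (hd : 0 < d) (hu : IsPrimitiveRoot u d) {v : ℂ} (hv : IsPrimitiveRoot v d) :
    minpoly ℤ (theta u) = minpoly ℤ (theta v) := by
  have key : aeval (theta v) (minpoly ℤ (theta u)) = 0 := by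
    -- On d-th roots of unity w⁻¹ = w^(d-1), so θ becomes a polynomial, and irreducibility of the
    -- cyclotomic polynomial carries vanishing from u to v.
    set P : ℤ[X] := (minpoly ℤ (theta u)).comp (2 - (X + X ^ (d - 1))) with hP
    have hinv : ∀ w : ℂ, IsPrimitiveRoot w d → aeval w P = aeval (theta w) (minpoly ℤ (theta u)) := by
      intro w hw
      have h1 : w ^ (d - 1) = w⁻¹ := by
        apply eq_inv_of_mul_eq_one_left
        rw [pow_sub_one_mul hd.ne', hw.pow_eq_one]
      have h2 : aeval w (2 : ℤ[X]) = 2 := map_ofNat _ 2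
      rw [hP, aeval_comp]
      simp [h1, h2, theta]
    have h0 : aeval u P = 0 := by rw [hinv u hu, minpoly.aeval]
    have hdvd := minpoly.isIntegrallyClosed_dvd (hu.isIntegral hd) h0
    rw [← cyclotomic_eq_minpoly hu hd, cyclotomic_eq_minpoly hv hd] at hdvd
    rw [← hinv v hv]
    obtain ⟨Q, hQ⟩ := hdvd
    rw [hQ, map_mul, minpoly.aeval, zero_mul]
  have hiu := isIntegral_theta hd hu
  have hiv := isIntegral_theta hd hv
  have h1 := minpoly.isIntegrallyClosed_dvd hiv key
  have h2 : aeval (theta v) (minpoly ℚ (theta u)) = 0 := by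
    rw [← minpoly_theta_map hd hu, show Int.castRingHom ℚ = algebraMap ℤ ℚ from rfl,
      aeval_map_algebraMap]
    exact key
  have h3 := minpoly.eq_of_irreducible_of_monic (minpoly.irreducible hiu.tower_top) h2
    (minpoly.monic hiu.tower_top)
  apply map_injective (Int.castRingHom ℚ) Int.cast_injective
  rw [minpoly_theta_map hd hu, minpoly_theta_map hd hv, h3]

/-- Conjugation inverts u, hence fixes θ(u). This keeps u out of ℚ(θ(u)) when d > 2. -/
lemma conj_eq_self_of_mem {d : ℕ} {u : ℂ} (hd : 0 < d) (hu : IsPrimitiveRoot u d) {x : ℂ}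
    (hx : x ∈ ℚ⟮theta u⟯) : starRingEnd ℂ x = x := by
  have hnorm : starRingEnd ℂ u = u⁻¹ := by
    rw [Complex.inv_def, Complex.normSq_eq_norm_sq, hu.norm'_eq_one hd.ne']
    simp
  have hc : starRingEnd ℂ (theta u) = theta u := by
    rw [theta, map_sub, map_add, map_inv₀, hnorm, inv_inv, map_ofNat, add_comm]
  induction hx using adjoin_induction with
  | mem x hx => rw [Set.mem_singleton_iff.1 hx, hc]
  | algebraMap x => simp
  | add x y _ _ hx hy => rw [map_add, hx, hy]
  | inv x _ hx => rw [map_inv₀, hx]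
  | mul x y _ _ hx hy => rw [map_mul, hx, hy]

lemma natDegree_minpoly_adjoin_theta (hd : 2 < d) (hu : IsPrimitiveRoot u d) :
    (minpoly ℚ⟮theta u⟯ u).natDegree = 2 := by
  have hu0 : u ≠ 0 := hu.ne_zero (by omega)
  have hint : IsIntegral ℚ⟮theta u⟯ u := (hu.isIntegral (by omega)).tower_top
  apply le_antisymm
  · set P : ℚ⟮theta u⟯[X] := X ^ 2 - C (2 - AdjoinSimple.gen ℚ (theta u)) * X + C 1 with hP
    have hdeg : P.natDegree = 2 := by rw [hP]; compute_degree!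
    have hP0 : P ≠ 0 := by rintro h; rw [h] at hdeg; simp at hdeg
    rw [← hdeg]
    refine natDegree_le_of_dvd (minpoly.dvd _ _ ?_) hP0
    have := theta_mul_self hu0
    have h2 : algebraMap ℚ⟮theta u⟯ ℂ 2 = 2 := map_ofNat _ 2
    simp only [hP, map_add, map_sub, map_mul, map_pow, aeval_X, aeval_C, map_one,
      AdjoinSimple.algebraMap_gen, h2]
    linear_combination this
  · rw [minpoly.two_le_natDegree_iff hint]
    rintro ⟨y, hy⟩
    have hc := conj_eq_self_of_mem (by omega) hu y.2
    rw [show (y : ℂ) = u from hy] at hc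
    have hnorm : starRingEnd ℂ u = u⁻¹ := by
      rw [Complex.inv_def, Complex.normSq_eq_norm_sq, hu.norm'_eq_one (by omega)]
      simp
    have hsq : u ^ 2 = 1 := by
      rw [sq]; nth_rewrite 1 [← hc]; rw [hnorm, inv_mul_cancel₀ hu0]
    exact absurd (Nat.le_of_dvd (by norm_num) (hu.dvd_of_pow_eq_one 2 hsq)) (by omega)

lemma natDegree_minpoly_theta (hd : 2 < d) (hu : IsPrimitiveRoot u d) :
    2 * (minpoly ℤ (theta u)).natDegree = d.totient := by
  have hd0 : 0 < d := by omega
  have hθ : IsIntegral ℚ (theta u) := (isIntegral_theta hd0 hu).tower_top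
  have hint : IsIntegral ℚ⟮theta u⟯ u := (hu.isIntegral hd0).tower_top
  have h1 : ℚ⟮theta u, u⟯ = ℚ⟮u⟯ := by
    apply le_antisymm
    · rw [adjoin_le_iff]
      rintro x (rfl | rfl)
      · exact theta_mem_adjoin u
      · exact mem_adjoin_simple_self ℚ _
    · exact adjoin.mono _ _ _ (by simp)
  have h2 := Module.finrank_mul_finrank ℚ ℚ⟮theta u⟯ ℚ⟮theta u⟯⟮u⟯
  rw [adjoin.finrank hint, natDegree_minpoly_adjoin_theta hd hu, adjoin.finrank hθ,
    ← minpoly_theta_map hd0 hu, (minpoly.monic (isIntegral_theta hd0 hu)).natDegree_map] at h2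
  rw [mul_comm, h2, ← finrank_adjoin_primitiveRoot hd0 hu, ← h1, ← adjoin_simple_adjoin_simple]
  rfl

end Root

/-! ### The ring of integers of ℚ(θ(u)). -/

section Integral

variable {d : ℕ} {u : ℂ}

/-- As ℤ[u] is the ring of integers, the value is an integer polynomial in u. Reduced modulo the
cyclotomic polynomial it has degree below φ(d), where coefficients are unique. -/
lemma exists_int_map_of_isIntegral (hd : 0 < d) (hu : IsPrimitiveRoot u d) {p : ℚ[X]}
    (hp : p.natDegree < d.totient) (hint : IsIntegral ℤ (aeval u p)) :
    ∃ q : ℤ[X], q.map (Int.castRingHom ℚ) = p := by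
  have : NeZero d := ⟨hd.ne'⟩
  have := isCyclotomicExtension_adjoin hu
  have hg : IsPrimitiveRoot (AdjoinSimple.gen ℚ u) d :=
    IsPrimitiveRoot.coe_submonoidClass_iff.1 hu
  have := IsCyclotomicExtension.Rat.isIntegralClosure_adjoin_singleton hg
  have hval : algebraMap ℚ⟮u⟯ ℂ (aeval (AdjoinSimple.gen ℚ u) p) = aeval u p := by
    rw [← aeval_algebraMap_apply, AdjoinSimple.algebraMap_gen]
  have hy : IsIntegral ℤ (aeval (AdjoinSimple.gen ℚ u) p) := by
    rwa [← isIntegral_algebraMap_iff (algebraMap ℚ⟮u⟯ ℂ).injective, hval]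
  obtain ⟨z, hz⟩ := (IsIntegralClosure.isIntegral_iff
    (A := Algebra.adjoin ℤ {AdjoinSimple.gen ℚ u})).1 hy
  obtain ⟨q, hq⟩ : ∃ q : ℤ[X], aeval (AdjoinSimple.gen ℚ u) q = (z : ℚ⟮u⟯) :=
    (Algebra.adjoin_singleton_eq_range_aeval ℤ (AdjoinSimple.gen ℚ u)).le z.2
  have hq' : aeval u q = aeval u p := by
    rw [← hval, ← hz]
    change _ = algebraMap ℚ⟮u⟯ ℂ (z : ℚ⟮u⟯)
    rw [← hq]
    rw [← aeval_algebraMap_apply, AdjoinSimple.algebraMap_gen]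
  have hroot : aeval u (cyclotomic d ℤ) = 0 := by
    rw [cyclotomic_eq_minpoly hu hd, minpoly.aeval]
  set r := q %ₘ cyclotomic d ℤ with hr
  have hr1 : aeval u r = aeval u p := by
    rw [hr, aeval_modByMonic_eq_self_of_root hroot, hq']
  have hr2 : r.natDegree < d.totient := by
    rw [← natDegree_cyclotomic d ℤ]
    refine natDegree_modByMonic_lt _ (cyclotomic.monic d ℤ) fun h => ?_
    have := natDegree_cyclotomic d ℤ
    rw [h, natDegree_one] at this
    exact absurd (Nat.totient_pos.2 hd) (by omega)
  refine ⟨r, sub_eq_zero.1 ?_⟩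
  refine eq_zero_of_dvd_of_natDegree_lt (p := cyclotomic d ℚ) ?_ ?_
  · rw [cyclotomic_eq_minpoly_rat hu hd]
    apply minpoly.dvd
    rw [map_sub, show Int.castRingHom ℚ = algebraMap ℤ ℚ from rfl, aeval_map_algebraMap, hr1,
      sub_self]
  · rw [natDegree_cyclotomic]
    refine (natDegree_sub_le _ _).trans_lt (max_lt ?_ hp)
    exact natDegree_map_le.trans_lt hr2

/-- Strip leading terms by induction: u^N p(θ(u)) is a polynomial in u of degree at most 2N < φ(d),
whose coefficient at 2N is ± that of p at N, so the latter is an integer. -/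
lemma exists_int_map_of_isIntegral_theta (hd : 0 < d) (hu : IsPrimitiveRoot u d) (N : ℕ) :
    ∀ p : ℚ[X], p.natDegree < N → 2 * N ≤ d.totient + 1 → IsIntegral ℤ (aeval (theta u) p) →
      ∃ q : ℤ[X], q.map (Int.castRingHom ℚ) = p := by
  induction N with
  | zero => intro p hp; omega
  | succ N ih =>
    intro p hp hN hint
    have hu0 : u ≠ 0 := hu.ne_zero hd.ne'
    -- Since uθ(u) = -(u - 1)², `g i` represents u^N θ(u)^i; only i = N reaches degree 2N.
    set g : ℕ → ℚ[X] := fun i => X ^ (N - i) * (C (-1) * (X - C 1) ^ 2) ^ i with hg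
    have hgdeg : ∀ i ≤ N, (g i).natDegree ≤ N + i := by
      intro i hi
      simp only [hg]
      refine natDegree_mul_le.trans ?_
      have h1 : (C (-1) * (X - C 1) ^ 2 : ℚ[X]).natDegree ≤ 2 := by
        refine (natDegree_C_mul_le _ _).trans (natDegree_pow_le.trans ?_)
        rw [natDegree_X_sub_C]
      have h2 := natDegree_pow_le_of_le i h1
      rw [natDegree_X_pow]; omega
    have hgu : ∀ i ≤ N, aeval u (g i) = u ^ N * theta u ^ i := by
      intro i hi
      have h := theta_mul_self hu0
      simp only [hg, map_mul, map_pow, aeval_X, map_sub, map_one, map_neg]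
      rw [show (-1 : ℂ) * (u - 1) ^ 2 = u * theta u by rw [h]; ring, mul_pow, ← mul_assoc,
        ← pow_add, Nat.sub_add_cancel hi]
    have hglead : (g N).coeff (2 * N) = (-1) ^ N := by
      have h1 : ((X - C 1 : ℚ[X]) ^ (2 * N)).coeff (2 * N) = 1 := by
        have h := (monic_X_sub_C (1 : ℚ)).pow (2 * N)
        have h2 := h.coeff_natDegree
        rwa [(monic_X_sub_C (1 : ℚ)).natDegree_pow, natDegree_X_sub_C, mul_one] at h2
      simp only [hg, Nat.sub_self, pow_zero, one_mul]
      rw [mul_pow, ← pow_mul, ← C_pow, coeff_C_mul, h1, mul_one]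
    set G : ℚ[X] := ∑ i ∈ Finset.range (N + 1), C (p.coeff i) * g i with hG
    have hGdeg : G.natDegree ≤ 2 * N := by
      refine natDegree_sum_le_of_forall_le _ _ fun i hi => ?_
      rw [Finset.mem_range] at hi
      refine (natDegree_C_mul_le _ _).trans ((hgdeg i (by omega)).trans (by omega))
    have hGu : aeval u G = u ^ N * aeval (theta u) p := by
      rw [aeval_eq_sum_range' (n := N + 1) hp, hG, map_sum, Finset.mul_sum]
      refine Finset.sum_congr rfl fun i hi => ?_
      rw [Finset.mem_range] at hi
      rw [map_mul, aeval_C, hgu i (by omega), Algebra.smul_def]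
      ring
    have hGlead : G.coeff (2 * N) = p.coeff N * (-1) ^ N := by
      rw [hG, finsetSum_coeff, Finset.sum_range_succ, coeff_C_mul, hglead, add_eq_right]
      refine Finset.sum_eq_zero fun i hi => ?_
      rw [Finset.mem_range] at hi
      rw [coeff_C_mul, coeff_eq_zero_of_natDegree_lt (p := g i)
        ((hgdeg i hi.le).trans_lt (by omega)), mul_zero]
    obtain ⟨Q, hQ⟩ := exists_int_map_of_isIntegral hd hu (p := G) (by omega)
      (by rw [hGu]; exact ((hu.isIntegral hd).pow N).mul hint)
    obtain ⟨c, hc⟩ : ∃ c : ℤ, (c : ℚ) = p.coeff N := by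
      refine ⟨Q.coeff (2 * N) * (-1) ^ N, ?_⟩
      have h1 : ((Q.coeff (2 * N) : ℤ) : ℚ) = G.coeff (2 * N) := by rw [← hQ, coeff_map]; rfl
      push_cast
      rw [h1, hGlead, mul_assoc, ← mul_pow]
      norm_num
    rcases Nat.eq_zero_or_pos N with rfl | hN0
    · refine ⟨C c, ?_⟩
      rw [map_C, eq_C_of_natDegree_eq_zero (p := p) (by omega), eq_intCast, hc]
    · set p' : ℚ[X] := p - C (c : ℚ) * X ^ N with hp'
      have hdeg : p'.natDegree < N := by
        refine Nat.lt_of_le_pred hN0 (natDegree_le_iff_coeff_eq_zero.2 fun m hm => ?_)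
        rw [hp', coeff_sub, coeff_C_mul, coeff_X_pow]
        rcases (Nat.le_of_pred_lt hm).eq_or_lt with rfl | hm
        · rw [if_pos rfl, hc, mul_one, sub_self]
        · rw [if_neg (by omega), coeff_eq_zero_of_natDegree_lt (by omega), mul_zero, sub_zero]
      have hint' : IsIntegral ℤ (aeval (theta u) p') := by
        rw [hp', map_sub, map_mul, aeval_C, map_pow, aeval_X]
        refine hint.sub (IsIntegral.mul ?_ ((isIntegral_theta hd hu).pow N))
        simpa using isIntegral_algebraMap (R := ℤ) (A := ℂ) (x := c)
      obtain ⟨q, hq⟩ := ih p' hdeg (by omega) hint'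
      refine ⟨q + C c * X ^ N, ?_⟩
      rw [Polynomial.map_add, hq, Polynomial.map_mul, map_C, Polynomial.map_pow, map_X, hp',
        eq_intCast, sub_add_cancel]

lemma monogenic_minpoly_theta (hd : 2 < d) (hu : IsPrimitiveRoot u d) :
    Monogenic (minpoly ℤ (theta u)) := by
  have hd0 : 0 < d := by omega
  refine ⟨minpoly.monic (isIntegral_theta hd0 hu), ?_, fun z hz => ?_⟩
  · rw [minpoly_theta_map hd0 hu]
    exact minpoly.irreducible (isIntegral_theta hd0 hu).tower_top
  obtain ⟨v, hv, rfl⟩ := exists_primitiveRoot_of_root hd0 hu hz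
  rw [minpoly_theta_eq hd0 hu hv]
  have hint := isIntegral_theta hd0 hv
  set K := ℚ⟮theta v⟯ with hK
  set N := (minpoly ℤ (theta v)).natDegree with hN
  have hN2 : 2 * N = d.totient := natDegree_minpoly_theta hd hv
  have hNQ : (minpoly ℚ (theta v)).natDegree = N := by
    rw [← minpoly_theta_map hd0 hv, (minpoly.monic hint).natDegree_map]
  have hNpos : 0 < N := by have := Nat.totient_pos.2 hd0; omega
  have hgint : IsIntegral ℤ (AdjoinSimple.gen ℚ (theta v)) := by
    rw [← isIntegral_algebraMap_iff (algebraMap K ℂ).injective, AdjoinSimple.algebraMap_gen]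
    exact hint
  set t : 𝓞 K := ⟨AdjoinSimple.gen ℚ (theta v), hgint⟩ with ht
  have hli : LinearIndependent ℤ fun i : Fin N => t ^ (i : ℕ) := by
    have h1 := linearIndependent_pow (K := ℚ) (theta v)
    rw [hNQ] at h1
    have h2 : LinearIndependent ℤ fun i : Fin N => theta v ^ (i : ℕ) :=
      h1.restrict_scalars (by
        intro a b hab
        simpa using hab)
    let φ : 𝓞 K →ₐ[ℤ] ℂ := ((algebraMap K ℂ).comp (algebraMap (𝓞 K) K)).toIntAlgHom
    refine LinearIndependent.of_comp φ.toLinearMap ?_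
    have e : (φ.toLinearMap ∘ fun i : Fin N => t ^ (i : ℕ)) = fun i : Fin N => theta v ^ (i : ℕ) :=
      funext fun i => map_pow φ t i
    rw [e]
    exact h2
  have hsp : ⊤ ≤ Submodule.span ℤ (Set.range fun i : Fin N => t ^ (i : ℕ)) := by
    rintro a -
    have haint : IsIntegral ℤ ((a : K) : ℂ) := a.2.algebraMap (B := ℂ)
    obtain ⟨P, hP⟩ : ∃ P : ℚ[X], aeval (theta v) P = ((a : K) : ℂ) := by
      have ha : ((a : K) : ℂ) ∈ Algebra.adjoin ℚ {theta v} :=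
        (adjoin_simple_toSubalgebra_of_isAlgebraic hint.tower_top.isAlgebraic).le (a : K).2
      rw [Algebra.adjoin_singleton_eq_range_aeval] at ha
      exact ha
    have hmon : (minpoly ℚ (theta v)).Monic := minpoly.monic hint.tower_top
    set p := P %ₘ minpoly ℚ (theta v) with hp
    have hpv : aeval (theta v) p = ((a : K) : ℂ) := by
      rw [hp, aeval_modByMonic_eq_self_of_root (minpoly.aeval _ _), hP]
    have hpdeg : p.natDegree < N := by
      rw [← hNQ]
      refine natDegree_modByMonic_lt _ hmon fun h => ?_
      rw [h, natDegree_one] at hNQ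
      omega
    obtain ⟨q, hq⟩ := exists_int_map_of_isIntegral_theta hd0 hv N p hpdeg (by omega)
      (by rw [hpv]; exact haint)
    have hqdeg : q.natDegree < N := by
      rwa [← hq, natDegree_map_eq_of_injective Int.cast_injective] at hpdeg
    have haq : a = aeval t q := by
      apply RingOfIntegers.ext
      apply (algebraMap K ℂ).injective
      change ((a : K) : ℂ) = algebraMap K ℂ (algebraMap (𝓞 K) K (aeval t q))
      rw [← aeval_algebraMap_apply, ← aeval_algebraMap_apply, ← hpv, ← hq,
        show Int.castRingHom ℚ = algebraMap ℤ ℚ from rfl, aeval_map_algebraMap]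
      rfl
    rw [haq, aeval_eq_sum_range' hqdeg]
    refine Submodule.sum_mem _ fun i hi => Submodule.smul_mem _ _ (Submodule.subset_span ?_)
    exact ⟨⟨i, Finset.mem_range.1 hi⟩, rfl⟩
  refine ⟨Module.Basis.mk hli hsp, fun i => ?_⟩
  rw [Module.Basis.mk_apply]
  rfl

end Integral

/-! ### The roots of w_n. -/

/-- At x = θ(u) the characteristic roots of the recurrence are -u and -u⁻¹; this is the closed form
with denominators cleared. -/
lemma aeval_theta_w {u : ℂ} (hu : u ≠ 0) (n : ℕ) :
    (-u) ^ n * (1 - u) * aeval (theta u) (w n) = u ^ (2 * n) - u := by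
  induction n using Nat.strong_induction_on with
  | _ n ih =>
    match n with
    | 0 => simp [w]
    | 1 => simp [w]; ring
    | n + 2 =>
      have h0 := ih n (by omega)
      have h1 := ih (n + 1) (by omega)
      have h := theta_mul_self hu
      have h2 : aeval (theta u) (2 : ℤ[X]) = 2 := map_ofNat _ 2
      simp only [w, map_sub, map_mul, aeval_X, eq_intCast, Int.cast_ofNat, h2]
      have hx : u * (theta u - 2) = -(u ^ 2 + 1) := by linear_combination h
      linear_combination (-(u * (theta u - 2))) * h1 - u ^ 2 * h0 - (u ^ (2 * (n + 1)) - u) * hx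

/-- Settles u = 1, where θ(u) = 0 and the identity above reads 0 = 0: this value is odd, hence
nonzero. -/
lemma eval_zero_w (n : ℕ) : (w n).eval 0 = (-1) ^ (n + 1) * (2 * n - 1) := by
  induction n using Nat.strong_induction_on with
  | _ n ih =>
    match n with
    | 0 => simp [w]
    | 1 => simp [w]
    | n + 2 =>
      simp only [w, eval_sub, eval_mul, eval_X, eval_C, ih n (by omega), ih (n + 1) (by omega)]
      push_cast
      ring

lemma aeval_theta_w_eq_zero_iff {u : ℂ} (hu : u ≠ 0) {n : ℕ} (hn : 1 ≤ n) :
    aeval (theta u) (w n) = 0 ↔ u ^ (2 * n - 1) = 1 ∧ u ≠ 1 := by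
  have h := aeval_theta_w hu n
  have hpow : u ^ (2 * n) = u * u ^ (2 * n - 1) := by
    rw [← pow_succ', Nat.sub_add_cancel (by omega)]
  constructor
  · intro h0
    refine ⟨?_, ?_⟩
    · rw [h0, mul_zero, hpow] at h
      exact mul_left_cancel₀ hu (by linear_combination -h)
    · rintro rfl
      have ht : theta 1 = algebraMap ℤ ℂ 0 := by simp [theta]; norm_num
      rw [ht, aeval_algebraMap_apply, map_eq_zero_iff _ (algebraMap ℤ ℂ).injective_int,
        coe_aeval_eq_eval, eval_zero_w] at h0
      rcases mul_eq_zero.1 h0 with h1 | h1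
      · exact pow_ne_zero _ (by norm_num) h1
      · omega
  · rintro ⟨h1, h2⟩
    rw [hpow, h1, mul_one, sub_self] at h
    exact (mul_eq_zero.1 h).resolve_left
      (mul_ne_zero (pow_ne_zero _ (neg_ne_zero.2 hu)) (sub_ne_zero.2 h2.symm))

/-! ### Ω_d as a minimal polynomial. -/

/-- -ζ² = exp(2πi n/(2n-1)), and n is prime to 2n-1. -/
lemma isPrimitiveRoot_neg_zeta_sq {n : ℕ} (hn : 1 ≤ n) :
    IsPrimitiveRoot (-(zeta n ^ 2)) (2 * n - 1) := by
  have hM : 2 * n - 1 ≠ 0 := by omega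
  have hcop : n.Coprime (2 * n - 1) := by
    have h : Nat.gcd n (2 * n - 1) ∣ 1 := by
      have h1 := Nat.dvd_sub ((Nat.gcd_dvd_left n (2 * n - 1)).mul_left 2)
        (Nat.gcd_dvd_right n (2 * n - 1))
      rwa [show 2 * n - (2 * n - 1) = 1 by omega] at h1
    exact Nat.dvd_one.1 h
  convert Complex.isPrimitiveRoot_exp_of_coprime n (2 * n - 1) hM hcop using 1
  have hc : ((2 * n - 1 : ℕ) : ℂ) = 2 * n - 1 := by
    rw [Nat.cast_sub (by omega)]; push_cast; ring
  have hc0 : (2 * n - 1 : ℂ) ≠ 0 := by rw [← hc]; exact_mod_cast hM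
  rw [zeta, ← Complex.exp_nat_mul, ← neg_one_mul, ← Complex.exp_pi_mul_I, ← Complex.exp_add, hc]
  congr 1
  push_cast
  field_simp
  ring

lemma Omega_eq (n d : ℕ) : Omega n d =
    ∏ j ∈ (Finset.Icc 1 (n - 1)).filter (fun j => Nat.gcd (2 * j - 1) (2 * n - 1) = (2 * n - 1) / d),
      (X - C (theta ((-(zeta n ^ 2)) ^ (2 * j - 1)))) := by
  refine Finset.prod_congr rfl fun j hj => ?_
  have hj1 := (Finset.mem_Icc.1 (Finset.mem_filter.1 hj).1).1
  rw [Odd.neg_pow ⟨j - 1, by omega⟩, ← pow_mul, theta, inv_neg]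
  congr 2
  ring

lemma isOmega_minpoly_theta {n d : ℕ} (hn : 2 ≤ n) (hd : d ∣ 2 * n - 1) (hd1 : 1 < d) {u : ℂ}
    (hu : IsPrimitiveRoot u d) : IsOmega n d (minpoly ℤ (theta u)) := by
  have hd0 : 0 < d := by omega
  set M := 2 * n - 1 with hM
  have hω := isPrimitiveRoot_neg_zeta_sq (n := n) (by omega)
  rw [← hM] at hω
  set ω := -(zeta n ^ 2) with hωdef
  have hω0 : ω ≠ 0 := hω.ne_zero (by omega)
  have hint := isIntegral_theta hd0 hu
  set F := (minpoly ℤ (theta u)).map (Int.castRingHom ℂ) with hF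
  have hFmon : F.Monic := (minpoly.monic hint).map _
  have hFsep : F.Separable := by
    have h : ((minpoly ℚ (theta u)).map (algebraMap ℚ ℂ)).Separable :=
      (minpoly.irreducible hint.tower_top).separable.map
    rw [← minpoly_theta_map hd0 hu, Polynomial.map_map] at h
    rwa [hF, ← RingHom.ext_int ((algebraMap ℚ ℂ).comp (Int.castRingHom ℚ)) (Int.castRingHom ℂ)]
  have hFroot : ∀ z, z ∈ F.roots.toFinset ↔ aeval z (minpoly ℤ (theta u)) = 0 := by
    intro z
    rw [Multiset.mem_toFinset, mem_roots hFmon.ne_zero, IsRoot.def, hF, eval_map]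
    rfl
  have horder : ∀ k : ℕ, 0 < k → orderOf (ω ^ k) = M / Nat.gcd k M := by
    intro k hk
    rw [orderOf_pow' _ hk.ne', ← hω.eq_orderOf, Nat.gcd_comm]
  have hFprod : F = ∏ a ∈ F.roots.toFinset, (X - C a) := by
    conv_lhs => rw [(IsAlgClosed.splits F).eq_prod_roots_of_monic hFmon]
    rw [Finset.prod_multiset_map_count]
    refine Finset.prod_congr rfl fun a ha => ?_
    rw [Multiset.count_eq_one_of_mem (nodup_roots hFsep) (Multiset.mem_toFinset.1 ha), pow_one]
  rw [IsOmega, Omega_eq, ← hF, hFprod, ← hM, ← hωdef]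
  symm
  refine Finset.prod_nbij (fun j => theta (ω ^ (2 * j - 1))) ?_ ?_ ?_ fun _ _ => rfl
  · intro j hj
    obtain ⟨hj1, hj2⟩ := Finset.mem_filter.1 hj
    rw [Finset.mem_Icc] at hj1
    have hp : IsPrimitiveRoot (ω ^ (2 * j - 1)) d := by
      rw [IsPrimitiveRoot.iff_orderOf, horder _ (by omega), hj2, Nat.div_div_self hd (by omega)]
    rw [hFroot, minpoly_theta_eq hd0 hu hp, minpoly.aeval]
  · intro i hi j hj hij
    have hi1 := Finset.mem_Icc.1 (Finset.mem_filter.1 hi).1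
    have hj1 := Finset.mem_Icc.1 (Finset.mem_filter.1 hj).1
    rcases (theta_eq_iff (pow_ne_zero _ hω0) (pow_ne_zero _ hω0)).1 hij with h | h
    · have := hω.pow_inj (by omega) (by omega) h
      omega
    -- Inverse powers would make the odd number M divide 2(i + j - 1), but 0 < i + j - 1 < M.
    · rw [← mul_eq_one_iff_eq_inv₀ (pow_ne_zero _ hω0), ← pow_add] at h
      have h1 := hω.dvd_of_pow_eq_one _ h
      rw [show 2 * i - 1 + (2 * j - 1) = 2 * (i + j - 1) by omega] at h1
      have h2 := Nat.Coprime.dvd_of_dvd_mul_left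
        (Nat.Coprime.symm ((Nat.coprime_two_left).2 ⟨n - 1, by omega⟩)) h1
      have := Nat.le_of_dvd (by omega) h2
      omega
  · intro z hz
    obtain ⟨v, hv, rfl⟩ := exists_primitiveRoot_of_root hd0 hu ((hFroot z).1 hz)
    have key : ∀ v : ℂ, IsPrimitiveRoot v d → ∀ j, 1 ≤ j → j ≤ n - 1 → ω ^ (2 * j - 1) = v →
        j ∈ (Finset.Icc 1 (n - 1)).filter (fun j => Nat.gcd (2 * j - 1) M = M / d) := by
      intro v hv j h1 h2 h3
      refine Finset.mem_filter.2 ⟨Finset.mem_Icc.2 ⟨h1, h2⟩, ?_⟩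
      have h4 := horder (2 * j - 1) (by omega)
      rw [h3, ← hv.eq_orderOf] at h4
      rw [h4, Nat.div_div_self (Nat.gcd_dvd_right _ _) (by omega)]
    have hvM : v ^ M = 1 := (hv.pow_eq_one_iff_dvd M).2 hd
    have : NeZero M := ⟨by omega⟩
    obtain ⟨k, hk, rfl⟩ := hω.eq_pow_of_pow_eq_one hvM
    have hk0 : k ≠ 0 := by
      rintro rfl
      rw [pow_zero] at hv
      exact hd1.ne' (hv.unique IsPrimitiveRoot.one)
    -- The index set covers the odd exponents below M. An even exponent 2j is traded for M - 2j,
    -- which inverts the root and keeps θ.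
    rcases Nat.even_or_odd' k with ⟨j, rfl | rfl⟩
    · have hinv : ω ^ (2 * (n - j) - 1) = (ω ^ (2 * j))⁻¹ := by
        rw [← mul_eq_one_iff_eq_inv₀ (pow_ne_zero _ hω0), ← pow_add,
          show 2 * (n - j) - 1 + 2 * j = M by omega, hω.pow_eq_one]
      refine ⟨n - j, key _ hv.inv _ (by omega) (by omega) hinv, ?_⟩
      change theta (ω ^ (2 * (n - j) - 1)) = _
      rw [hinv, theta_inv]
    · exact ⟨j + 1, key _ hv _ (by omega) (by omega) (by congr 1), by congr 1⟩

/-! ### Units modulo d up to sign. -/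

/-- The unit group modulo `d` has an element generating it modulo `{1, -1}`. -/
def UnitsCyclicModSign (d : ℕ) : Prop :=
  ∃ y : (ZMod d)ˣ, ∀ k : ℕ, y ^ k = 1 ∨ y ^ k = -1 → d.totient ∣ 2 * k

lemma exists_unit_pow_eq_one_dvd {m : ℕ} [NeZero m] [IsCyclic (ZMod m)ˣ] :
    ∃ g : (ZMod m)ˣ, ∀ k : ℕ, g ^ k = 1 ↔ m.totient ∣ k := by
  obtain ⟨g, hg⟩ := IsCyclic.exists_ofOrder_eq_natCard (α := (ZMod m)ˣ)
  rw [Nat.card_eq_fintype_card, ZMod.card_units_eq_totient] at hg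
  exact ⟨g, fun k => by rw [← hg, orderOf_dvd_iff_pow_eq_one]⟩

lemma neg_one_ne_one_units {m : ℕ} (hm : 2 < m) : (-1 : (ZMod m)ˣ) ≠ 1 := by
  have : Fact (2 < m) := ⟨hm⟩
  intro h
  exact ZMod.neg_one_ne_one (congrArg Units.val h)

lemma unitsCyclicModSign_of_isCyclic {m : ℕ} [NeZero m] [IsCyclic (ZMod m)ˣ] :
    UnitsCyclicModSign m := by
  obtain ⟨g, hg⟩ := exists_unit_pow_eq_one_dvd (m := m)
  refine ⟨g, fun k hk => (hg _).1 ?_⟩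
  rw [mul_comm, pow_mul]
  rcases hk with h | h <;> rw [h] <;> simp

/-- Take generators g, h. Since g² has odd order a, no power of (g², h) is -1; since a is prime to
φ(n), its order is aφ(n) = φ(mn)/2. -/
lemma unitsCyclicModSign_mul {m n : ℕ} (hm : 2 < m) (hn : 2 < n) [IsCyclic (ZMod m)ˣ]
    [IsCyclic (ZMod n)ˣ] (hcop : m.Coprime n) {a : ℕ} (ha : m.totient = 2 * a) (hodd : Odd a)
    (hgcd : Nat.gcd m.totient n.totient = 2) : UnitsCyclicModSign (m * n) := by
  have : NeZero m := ⟨by omega⟩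
  have : NeZero n := ⟨by omega⟩
  obtain ⟨g, hg⟩ := exists_unit_pow_eq_one_dvd (m := m)
  obtain ⟨h, hh⟩ := exists_unit_pow_eq_one_dvd (m := n)
  let e : (ZMod (m * n))ˣ ≃* (ZMod m)ˣ × (ZMod n)ˣ :=
    (Units.mapEquiv (ZMod.chineseRemainder hcop).toMulEquiv).trans MulEquiv.prodUnits
  have hneg : e (-1) = (-1, -1) := by
    have h1 : ZMod.chineseRemainder hcop (-1) = -1 := by rw [map_neg, map_one]
    apply Prod.ext
    · exact Units.ext (congrArg Prod.fst h1)
    · exact Units.ext (congrArg Prod.snd h1)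
  refine ⟨e.symm (g ^ 2, h), fun k hk => ?_⟩
  have hy : e (e.symm (g ^ 2, h) ^ k) = ((g ^ 2) ^ k, h ^ k) := by
    rw [map_pow, e.apply_symm_apply, Prod.pow_mk]
  rcases hk with hk | hk <;> rw [hk] at hy
  · rw [map_one, Prod.ext_iff] at hy
    have h1 := (hg (2 * k)).1 (by rw [pow_mul]; exact hy.1.symm)
    have h2 := (hh k).1 hy.2.symm
    rw [ha] at h1
    have h3 : a ∣ k := (Nat.mul_dvd_mul_iff_left two_pos).1 h1
    have hc : Nat.Coprime a n.totient := by
      have h4 : Nat.gcd a n.totient ∣ 2 := hgcd ▸ Nat.gcd_dvd_gcd_of_dvd_left _ ⟨2, by omega⟩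
      rcases (Nat.dvd_prime Nat.prime_two).1 h4 with h5 | h5
      · exact h5
      · have := h5 ▸ Nat.gcd_dvd_left a n.totient
        exact absurd this hodd.not_two_dvd_nat
    rw [Nat.totient_mul hcop, ha, mul_assoc]
    exact Nat.mul_dvd_mul_left 2 (hc.mul_dvd_of_dvd_of_dvd h3 h2)
  · rw [hneg, Prod.ext_iff] at hy
    have h1 : ((g ^ 2) ^ k) ^ a = (-1) ^ a := congrArg (· ^ a) hy.1.symm
    rw [hodd.neg_one_pow, ← pow_mul, ← pow_mul,
      (hg (2 * (k * a))).2 ⟨k, by rw [ha]; ring⟩] at h1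
    exact absurd h1.symm (neg_one_ne_one_units hm)

/-- A gcd of 2 means that one totient is not divisible by 4; that factor takes the role of m above.
-/
lemma unitsCyclicModSign_mul_of_gcd {m n : ℕ} (hm : 2 < m) (hn : 2 < n) [IsCyclic (ZMod m)ˣ]
    [IsCyclic (ZMod n)ˣ] (hcop : m.Coprime n)
    (hgcd : Nat.gcd m.totient n.totient = 2) : UnitsCyclicModSign (m * n) := by
  obtain ⟨a, ha⟩ := (Nat.totient_even hm).two_dvd
  obtain ⟨b, hb⟩ := (Nat.totient_even hn).two_dvd
  rcases Nat.even_or_odd a with hae | hao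
  · rcases Nat.even_or_odd b with hbe | hbo
    · have h : 4 ∣ Nat.gcd m.totient n.totient := by
        obtain ⟨a', rfl⟩ := hae.two_dvd
        obtain ⟨b', rfl⟩ := hbe.two_dvd
        exact Nat.dvd_gcd ⟨a', by omega⟩ ⟨b', by omega⟩
      rw [hgcd] at h
      omega
    · rw [mul_comm]
      exact unitsCyclicModSign_mul hn hm hcop.symm hb hbo (by rw [Nat.gcd_comm, hgcd])
  · exact unitsCyclicModSign_mul hm hn hcop ha hao hgcd

lemma two_lt_prime_pow {p c : ℕ} (hp : p.Prime) (hp2 : Odd p) (hc : c ≠ 0) : 2 < p ^ c := by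
  have h1 := hp.two_le
  have h2 : p ≠ 2 := by rintro rfl; exact absurd hp2 (by decide)
  have h3 := Nat.le_self_pow hc p
  omega

lemma OddShape.unitsCyclicModSign_of_dvd {M d : ℕ} (hM : OddShape M) (hd : d ∣ M) (hd1 : 1 < d) :
    UnitsCyclicModSign d := by
  have hcyc : ∀ p c : ℕ, p.Prime → Odd p → IsCyclic (ZMod (p ^ c))ˣ := fun p c hp hp2 =>
    ZMod.isCyclic_units_of_prime_pow p hp (by rintro rfl; exact absurd hp2 (by decide)) c
  have hpow : ∀ p c : ℕ, p.Prime → Odd p → UnitsCyclicModSign (p ^ c) := fun p c hp hp2 => by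
    have := hcyc p c hp hp2
    have : NeZero (p ^ c) := ⟨pow_ne_zero _ hp.ne_zero⟩
    exact unitsCyclicModSign_of_isCyclic
  rcases hM with ⟨p, a, hp, hp2, -, rfl⟩ | ⟨p, q, a, b, hp, hp2, hq, hq2, hpq, -, -, rfl, hgcd⟩
  · obtain ⟨c, -, rfl⟩ := (Nat.dvd_prime_pow hp).1 hd
    exact hpow p c hp hp2
  · obtain ⟨k₁, k₂, hk₁, hk₂, rfl⟩ := Nat.dvd_mul.1 hd
    obtain ⟨c, hc, rfl⟩ := (Nat.dvd_prime_pow hp).1 hk₁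
    obtain ⟨e, he, rfl⟩ := (Nat.dvd_prime_pow hq).1 hk₂
    rcases eq_or_ne c 0 with rfl | hc0
    · rw [pow_zero, one_mul]; exact hpow q e hq hq2
    rcases eq_or_ne e 0 with rfl | he0
    · rw [pow_zero, mul_one]; exact hpow p c hp hp2
    have := hcyc p c hp hp2
    have := hcyc q e hq hq2
    have h1 := two_lt_prime_pow hp hp2 hc0
    have h2 := two_lt_prime_pow hq hq2 he0
    refine unitsCyclicModSign_mul_of_gcd h1 h2
      (Nat.Coprime.pow _ _ ((Nat.coprime_primes hp hq).2 hpq)) (Nat.dvd_antisymm ?_ ?_)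
    · rw [← hgcd]
      exact Nat.dvd_gcd ((Nat.gcd_dvd_left _ _).trans (Nat.totient_dvd_of_dvd hk₁))
        ((Nat.gcd_dvd_right _ _).trans (Nat.totient_dvd_of_dvd hk₂))
    · exact Nat.dvd_gcd (Nat.totient_even h1).two_dvd (Nat.totient_even h2).two_dvd

/-! ### The Galois group. -/

/-- Restriction from Gal(ℚ(u)/ℚ) ≅ (ℤ/d)ˣ kills the automorphism τ of -1, so the group has order at
most N = φ(d)/2. If the restriction of σ^k is trivial, σ^k fixes θ(u), so it sends u to u or u⁻¹;
then y^k = ±1 and N divides k. So σ restricts to a generator. -/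
lemma cyclic_minpoly_theta {d : ℕ} {u : ℂ} (hd : 2 < d) (hu : IsPrimitiveRoot u d)
    (hcyc : UnitsCyclicModSign d) : Cyclic (minpoly ℤ (theta u)) := by
  have hd0 : 0 < d := by omega
  have : NeZero d := ⟨hd0.ne'⟩
  have hint := isIntegral_theta hd0 hu
  have hirr := minpoly.irreducible (A := ℚ) hint.tower_top
  have hdeg := natDegree_minpoly_theta hd hu
  refine ⟨minpoly.monic hint, by rwa [minpoly_theta_map hd0 hu], ?_⟩
  set N := (minpoly ℤ (theta u)).natDegree with hN
  rw [minpoly_theta_map hd0 hu]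
  set K := ℚ⟮u⟯ with hK
  have := isCyclotomicExtension_adjoin hu
  have : FiniteDimensional ℚ K := IsCyclotomicExtension.finiteDimensional {d} ℚ K
  have : IsGalois ℚ K := IsCyclotomicExtension.isGalois {d} ℚ K
  set g : K := AdjoinSimple.gen ℚ u with hg
  have hgp : IsPrimitiveRoot g d := IsPrimitiveRoot.coe_submonoidClass_iff.1 hu
  set x : K := ⟨theta u, theta_mem_adjoin u⟩ with hx
  set f := minpoly ℚ (theta u) with hf
  have hmin : minpoly ℚ x = f := (minpoly.algebraMap_eq (algebraMap K ℂ).injective x).symm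
  have : Fact ((f.map (algebraMap ℚ K)).Splits) := ⟨hmin ▸ Normal.splits inferInstance x⟩
  have htheta : ∀ (ρ : Gal(K/ℚ)) (z : K) (v : K), (z : ℂ) = theta v → ((ρ z : K) : ℂ) = theta (ρ v : K) := by
    intro ρ z v h
    have h1 : z = 2 - (v + v⁻¹) := Subtype.ext h
    have h2 : ρ 2 = 2 := map_ofNat ρ 2
    rw [h1, map_sub, map_add, map_inv₀, h2]
    rfl
  set e := hgp.autToPow ℚ with he
  have hspec : ∀ ρ : Gal(K/ℚ), g ^ (e ρ : ZMod d).val = ρ g := fun ρ => hgp.autToPow_spec ℚ ρ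
  have heq : ∀ ρ ρ' : Gal(K/ℚ), ρ g = ρ' g → e ρ = e ρ' := by
    intro ρ ρ' h
    rw [← hspec, ← hspec] at h
    exact Units.ext (ZMod.val_injective d
      (hgp.pow_inj (ZMod.val_lt _) (ZMod.val_lt _) h))
  have hcardK : Nat.card Gal(K/ℚ) = d.totient := by
    rw [IsGalois.card_aut_eq_finrank, finrank_adjoin_primitiveRoot hd0 hu]
  have hebij : Function.Bijective e := by
    have h1 : Function.Injective e := hgp.autToPow_injective ℚ
    refine (Nat.bijective_iff_injective_and_card e).2 ⟨h1, ?_⟩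
    rw [hcardK, Nat.card_eq_fintype_card, ZMod.card_units_eq_totient]
  obtain ⟨τ, hτ⟩ := hebij.2 (-1)
  obtain ⟨y, hy⟩ := hcyc
  obtain ⟨σ, hσ⟩ := hebij.2 y
  have hτg : τ g = g⁻¹ := by
    apply eq_inv_of_mul_eq_one_left
    rw [← hspec, hτ, ← pow_succ, hgp.pow_eq_one_iff_dvd, ← ZMod.natCast_eq_zero_iff]
    simp
  set R := Gal.restrict f K with hR
  have hRsurj : Function.Surjective R := Gal.restrict_surjective f K
  have hRτ : R τ = 1 := by
    apply Gal.galActionHom_injective f K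
    ext1 z
    rw [map_one]
    apply Subtype.ext
    change ((R τ • z : f.rootSet K) : K) = z
    rw [hR, Gal.restrict_smul]
    have hz := (mem_rootSet.1 z.2).2
    have hz' : aeval ((z : K) : ℂ) (minpoly ℤ (theta u)) = 0 := by
      rw [← aeval_map_algebraMap ℚ, show algebraMap ℤ ℚ = Int.castRingHom ℚ from rfl,
        minpoly_theta_map hd0 hu]
      change aeval (algebraMap K ℂ z) f = 0
      rw [aeval_algebraMap_apply, hz, map_zero]
    obtain ⟨v, hv, hzv⟩ := exists_primitiveRoot_of_root hd0 hu hz'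
    obtain ⟨i, -, rfl⟩ := hu.eq_pow_of_pow_eq_one hv.pow_eq_one
    have h1 := htheta τ z (g ^ i) hzv
    rw [map_pow, hτg, inv_pow] at h1
    apply Subtype.ext
    rw [h1, hzv, ← theta_inv (u ^ i)]
    rfl
  have hcard : Nat.card f.Gal ≤ N := by
    have h1 := Subgroup.card_eq_card_quotient_mul_card_subgroup R.ker
    rw [Nat.card_congr (QuotientGroup.quotientKerEquivOfSurjective R hRsurj).toEquiv, hcardK,
      ← hdeg] at h1
    have h2 : 1 < Nat.card R.ker := by
      refine (Subgroup.one_lt_card_iff_ne_bot _).2 fun h => ?_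
      have h3 : τ ∈ R.ker := hRτ
      rw [h, Subgroup.mem_bot] at h3
      rw [h3, map_one] at hτ
      exact neg_one_ne_one_units hd hτ.symm
    nlinarith
  have hord : N ∣ orderOf (R σ) := by
    have h1 : R (σ ^ orderOf (R σ)) = 1 := by rw [map_pow, pow_orderOf_eq_one]
    set k := orderOf (R σ) with hk
    have hxr : x ∈ f.rootSet K := by
      rw [mem_rootSet]
      exact ⟨hirr.ne_zero, hmin ▸ minpoly.aeval ℚ x⟩
    have h2 := Gal.restrict_smul (p := f) (σ ^ k) ⟨x, hxr⟩
    rw [← hR, h1, one_smul] at h2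
    have h3 := htheta (σ ^ k) x g rfl
    rw [← h2] at h3
    have hg0 : g ≠ 0 := hgp.ne_zero hd0.ne'
    have h4 : u = ((σ ^ k) g : K) ∨ u = (((σ ^ k) g : K) : ℂ)⁻¹ :=
      (theta_eq_iff (hu.ne_zero hd0.ne')
        (fun h => (map_ne_zero (σ ^ k)).2 hg0 (Subtype.ext h))).1 h3
    have h5 := hy k (by
      rw [← hσ, ← map_pow]
      rcases h4 with h4 | h4
      · left
        rw [← map_one e]
        exact heq _ _ (Subtype.ext h4.symm)
      · right
        rw [← hτ]
        refine heq _ _ ?_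
        rw [hτg]
        exact Subtype.ext (inv_eq_iff_eq_inv.1 h4.symm))
    rw [← hdeg] at h5
    exact (Nat.mul_dvd_mul_iff_left two_pos).1 h5
  have : Finite f.Gal := Finite.of_surjective R hRsurj
  have hord2 : orderOf (R σ) ≤ Nat.card f.Gal := orderOf_le_card
  have hord3 : N ≤ orderOf (R σ) := Nat.le_of_dvd (orderOf_pos _) hord
  have hcardN : Nat.card f.Gal = N := by omega
  have : IsCyclic f.Gal := isCyclic_of_orderOf_eq_card (R σ) (by omega)
  rw [← hcardN]
  exact ⟨(zmodCyclicMulEquiv this).symm⟩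

/-! ### Different orders give different fields. -/

/-- If `L` is an odd multiple of `m` with `φ L ≤ 2 φ m`, then `L = m` or `L = 3 m`. -/
lemma eq_or_eq_three_mul_of_totient_le {m L : ℕ} (hL : Odd L) (hmL : m ∣ L)
    (h : L.totient ≤ 2 * m.totient) : L = m ∨ L = 3 * m := by
  obtain ⟨k, rfl⟩ := hmL
  obtain ⟨hmo, hko⟩ := Nat.odd_mul.1 hL
  have hm0 : 0 < m.totient := Nat.totient_pos.2 hmo.pos
  have h1 := (Nat.totient_super_multiplicative m k).trans h
  have h2 : k.totient ≤ 2 := by nlinarith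
  have h3 : k < 5 := by
    by_contra! hk
    -- For odd k ≥ 5 the residues 1, 2, 4 are units, so φ(k) ≥ 3.
    have hsub : ({1, 2, 4} : Finset ℕ) ⊆ {a ∈ Finset.range k | k.Coprime a} := by
      have hk2 : k.Coprime 2 := hko.coprime_two_right
      intro a ha
      rw [Finset.mem_filter, Finset.mem_range]
      simp only [Finset.mem_insert, Finset.mem_singleton] at ha
      rcases ha with rfl | rfl | rfl
      · exact ⟨by omega, Nat.coprime_one_right k⟩
      · exact ⟨by omega, hk2⟩
      · exact ⟨by omega, hk2.mul_right hk2⟩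
    have h4 := Finset.card_le_card hsub
    rw [← Nat.totient_eq_card_coprime, show ({1, 2, 4} : Finset ℕ).card = 3 from rfl] at h4
    omega
  obtain ⟨r, rfl⟩ := hko
  obtain rfl | rfl : r = 0 ∨ r = 1 := by omega
  · left; omega
  · right; omega

lemma eq_of_totient_lcm_le {m n : ℕ} (hm : Odd m) (hn : Odd n) (hmn : m.totient = n.totient)
    (h : (m.lcm n).totient ≤ 2 * m.totient) : m = n := by
  have hL : Odd (m.lcm n) := (hm.mul hn).of_dvd_nat (Nat.lcm_dvd_mul m n)
  have hm0 : 0 < m.totient := Nat.totient_pos.2 hm.pos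
  -- Tripling at least doubles the totient.
  have key : ∀ m n : ℕ, m.totient = n.totient → 0 < m.totient → m ≠ 3 * n := by
    rintro m n h h0 rfl
    have h1 := Nat.totient_super_multiplicative 3 n
    have h2 : Nat.totient 3 = 2 := by decide
    rw [h, h2] at h1
    omega
  have h1 := eq_or_eq_three_mul_of_totient_le hL (Nat.dvd_lcm_left m n) h
  have h2 := eq_or_eq_three_mul_of_totient_le hL (Nat.dvd_lcm_right m n) (hmn ▸ h)
  rcases h1 with h1 | h1 <;> rcases h2 with h2 | h2
  · exact h1.symm.trans h2
  · exact absurd (h1.symm.trans h2) (key m n hmn hm0)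
  · exact absurd (h2.symm.trans h1) (key n m hmn.symm (hmn ▸ hm0))
  · omega

lemma eq_of_adjoin_theta_eq {m n : ℕ} {u v : ℂ} (hm : 2 < m) (hn : 2 < n) (hmo : Odd m)
    (hno : Odd n) (hu : IsPrimitiveRoot u m) (hv : IsPrimitiveRoot v n)
    (h : ℚ⟮theta u⟯ = ℚ⟮theta v⟯) : m = n := by
  have hm0 : 0 < m := by omega
  have hn0 : 0 < n := by omega
  have hfin : ∀ {d : ℕ} {u : ℂ}, 2 < d → IsPrimitiveRoot u d →
      2 * Module.finrank ℚ ℚ⟮theta u⟯ = d.totient := by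
    intro d u hd hu
    have hint := isIntegral_theta (by omega) hu
    rw [adjoin.finrank hint.tower_top, ← minpoly_theta_map (by omega) hu,
      (minpoly.monic hint).natDegree_map, natDegree_minpoly_theta hd hu]
  have hFu := hfin hm hu
  have hFv := hfin hn hv
  have hdu := natDegree_minpoly_adjoin_theta hm hu
  have hdv := natDegree_minpoly_adjoin_theta hn hv
  have hiu : IsIntegral ℚ⟮theta u⟯ u := (hu.isIntegral hm0).tower_top
  have hiv : IsIntegral ℚ⟮theta u⟯ v := (hv.isIntegral hn0).tower_top
  have hθu : IsIntegral ℚ (theta u) := (isIntegral_theta hm0 hu).tower_top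
  rw [← h] at hFv hdv
  set F := ℚ⟮theta u⟯ with hF
  have : FiniteDimensional ℚ F := adjoin.finiteDimensional hθu
  have : FiniteDimensional F F⟮u⟯ := adjoin.finiteDimensional hiu
  have : FiniteDimensional F F⟮v⟯ := adjoin.finiteDimensional hiv
  set E := F⟮u⟯ ⊔ F⟮v⟯ with hE
  have : FiniteDimensional F E := finiteDimensional_sup _ _
  have hE4 : Module.finrank F E ≤ 4 := by
    refine (finrank_sup_le F⟮u⟯ F⟮v⟯).trans ?_
    rw [adjoin.finrank hiu, adjoin.finrank hiv, hdu, hdv]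
  have hEQ := Module.finrank_mul_finrank ℚ F E
  have : FiniteDimensional ℚ E := FiniteDimensional.trans ℚ F E
  have huE : u ∈ E := (le_sup_left : F⟮u⟯ ≤ E) (mem_adjoin_simple_self F u)
  have hvE : v ∈ E := (le_sup_right : F⟮v⟯ ≤ E) (mem_adjoin_simple_self F v)
  have hz := hu.pow_mul_pow_lcm hv hm0.ne' hn0.ne'
  set z := u ^ (m / m.factorizationLCMLeft n) * v ^ (n / m.factorizationLCMRight n) with hzdef
  have hzE : z ∈ E.restrictScalars ℚ := mul_mem (pow_mem huE _) (pow_mem hvE _)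
  have hL0 : 0 < m.lcm n := Nat.lcm_pos hm0 hn0
  have : FiniteDimensional ℚ (E.restrictScalars ℚ) := this
  have hle : Module.finrank ℚ ℚ⟮z⟯ ≤ Module.finrank ℚ (E.restrictScalars ℚ) :=
    finrank_le_of_le_right (adjoin_simple_le_iff.2 hzE)
  rw [finrank_adjoin_primitiveRoot hL0 hz] at hle
  change _ ≤ Module.finrank ℚ E at hle
  refine eq_of_totient_lcm_le hmo hno (hFu.symm.trans hFv) ?_
  -- φ(lcm(m, n)) ≤ [E : ℚ] ≤ 4[F : ℚ] = 2φ(m).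
  nlinarith

/-! ### Factors of w_n and conclusion. -/

lemma exists_primitiveRoot_of_aeval_w {n : ℕ} (hn : 1 ≤ n) {z : ℂ} (hz : aeval z (w n) = 0) :
    ∃ (d : ℕ) (u : ℂ), d ∣ 2 * n - 1 ∧ 1 < d ∧ IsPrimitiveRoot u d ∧ z = theta u := by
  obtain ⟨u, hu0, rfl⟩ := exists_theta_eq z
  obtain ⟨h1, h2⟩ := (aeval_theta_w_eq_zero_iff hu0 hn).1 hz
  have hd : orderOf u ∣ 2 * n - 1 := orderOf_dvd_of_pow_eq_one h1
  have hpos := Nat.pos_of_dvd_of_pos hd (by omega)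
  have hne : orderOf u ≠ 1 := fun h => h2 (orderOf_eq_one_iff.1 h)
  exact ⟨orderOf u, u, hd, by omega, IsPrimitiveRoot.orderOf u, rfl⟩

lemma minpoly_theta_dvd_w {n d : ℕ} (hn : 1 ≤ n) (hd : d ∣ 2 * n - 1) (hd1 : 1 < d) {u : ℂ}
    (hu : IsPrimitiveRoot u d) : minpoly ℤ (theta u) ∣ w n := by
  refine minpoly.isIntegrallyClosed_dvd (isIntegral_theta (by omega) hu) ?_
  rw [aeval_theta_w_eq_zero_iff (hu.ne_zero (by omega)) hn]
  exact ⟨(hu.pow_eq_one_iff_dvd _).2 hd, hu.ne_one hd1⟩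

lemma ConditionC.unitsCyclicModSign_of_dvd {n d : ℕ} (hn : 1 ≤ n) (hC : ConditionC (2 * n - 1))
    (hd : d ∣ 2 * n - 1) (hd1 : 1 < d) : UnitsCyclicModSign d := by
  rcases hC.2 with ⟨-, h⟩ | ⟨h, -⟩
  · exact h.unitsCyclicModSign_of_dvd hd hd1
  · omega

lemma two_lt_of_dvd {n d : ℕ} (hn : 1 ≤ n) (hd : d ∣ 2 * n - 1) (hd1 : 1 < d) : 2 < d := by
  rcases eq_or_ne d 2 with rfl | h <;> omega

end RecMono

theorem corollary1p4 :
    (∀ n : ℕ, 2 ≤ n → RecMono.ConditionC (2 * n - 1) →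
      (∀ d : ℕ, d ∣ 2 * n - 1 → 1 < d →
        ∃ f : ℤ[X], RecMono.IsOmega n d f ∧ Irreducible (f.map (Int.castRingHom ℚ)) ∧
          f ∣ RecMono.w n ∧ RecMono.Monogenic f ∧ RecMono.Cyclic f) ∧
      (∀ f : ℤ[X], f.Monic → Irreducible (f.map (Int.castRingHom ℚ)) → f ∣ RecMono.w n →
        (∃ d : ℕ, d ∣ 2 * n - 1 ∧ 1 < d ∧ RecMono.IsOmega n d f) ∧
          RecMono.Monogenic f ∧ RecMono.Cyclic f)) ∧
    (∀ n₁ n₂ : ℕ, 2 ≤ n₁ → 2 ≤ n₂ → n₁ ≠ n₂ →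
      RecMono.ConditionC (2 * n₁ - 1) → RecMono.ConditionC (2 * n₂ - 1) →
      ∃ f g : ℤ[X], RecMono.IsOmega n₁ (2 * n₁ - 1) f ∧ RecMono.IsOmega n₂ (2 * n₂ - 1) g ∧
        RecMono.Distinct f g) := by
  open RecMono in
  refine ⟨fun n hn hC => ⟨fun d hd hd1 => ?_, fun f hf hirr hfw => ?_⟩,
    fun n₁ n₂ hn₁ hn₂ hne _ _ => ?_⟩
  · have hu := Complex.isPrimitiveRoot_exp d (by omega)
    have hd2 := two_lt_of_dvd (by omega) hd hd1
    have hmon := monogenic_minpoly_theta hd2 hu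
    exact ⟨_, isOmega_minpoly_theta hn hd hd1 hu, hmon.2.1,
      minpoly_theta_dvd_w (by omega) hd hd1 hu, hmon,
      cyclic_minpoly_theta hd2 hu (hC.unitsCyclicModSign_of_dvd (by omega) hd hd1)⟩
  · obtain ⟨z, hz⟩ := IsAlgClosed.exists_aeval_eq_zero ℂ (f.map (Int.castRingHom ℚ))
      (degree_pos_of_irreducible hirr).ne'
    have hz' : aeval z f = 0 := by
      rwa [show Int.castRingHom ℚ = algebraMap ℤ ℚ from rfl, aeval_map_algebraMap] at hz
    have hzw : aeval z (w n) = 0 := by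
      obtain ⟨q, hq⟩ := hfw
      rw [hq, map_mul, hz', zero_mul]
    obtain ⟨d, u, hd, hd1, hu, rfl⟩ := exists_primitiveRoot_of_aeval_w (by omega) hzw
    have hd2 := two_lt_of_dvd (by omega) hd hd1
    obtain rfl : f = minpoly ℤ (theta u) := by
      apply map_injective (Int.castRingHom ℚ) Int.cast_injective
      rw [minpoly_theta_map (by omega) hu]
      exact minpoly.eq_of_irreducible_of_monic hirr hz (hf.map _)
    exact ⟨⟨d, hd, hd1, isOmega_minpoly_theta hn hd hd1 hu⟩, monogenic_minpoly_theta hd2 hu,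
      cyclic_minpoly_theta hd2 hu (hC.unitsCyclicModSign_of_dvd (by omega) hd hd1)⟩
  · have hu := Complex.isPrimitiveRoot_exp (2 * n₁ - 1) (by omega)
    have hv := Complex.isPrimitiveRoot_exp (2 * n₂ - 1) (by omega)
    refine ⟨_, _, isOmega_minpoly_theta hn₁ dvd_rfl (by omega) hu,
      isOmega_minpoly_theta hn₂ dvd_rfl (by omega) hv, fun α β hα hβ h => ?_⟩
    obtain ⟨u', hu', rfl⟩ := exists_primitiveRoot_of_root (by omega) hu hα
    obtain ⟨v', hv', rfl⟩ := exists_primitiveRoot_of_root (by omega) hv hβ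
    have := eq_of_adjoin_theta_eq (by omega) (by omega) ⟨n₁ - 1, by omega⟩ ⟨n₂ - 1, by omega⟩
      hu' hv' h
    omega
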